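/- Let $\Gamma$ be a finite, undirected, simple, connected graph with distance function $d$ and diameter $D$ (the maximum distance between two vertices). Call $\Gamma$ distance-regular if there are integers $b_i, c_i$ ($0\le i\le D$) such that for any two vertices $x,y$ with $d(x,y)=i$, exactly $c_i$ neighbours of $y$ are at distance $i-1$ from $x$ and exactly $b_i$ neighbours of $y$ are at distance $i+1$ from $x$ (so $c_0=b_D=0$); then $\Gamma$ is regular with valency $k:=b_0$. Let $C\ge \frac12$ be a real number and $t$ a positive integer. Let $\Gamma$ be a distance-regular graph with valency $k$ and diameter $D\ge t+1$. If $\frac{b_t}{c_t}\le C$, then $D\le 8C^2t$ or $k\le 2C$. -/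

import Mathlib

/-- The connected graph `G` is distance-regular with intersection numbers `b i`, `c i`
(`0 ≤ i ≤ G.diam`): whenever `x, y` are at distance `i`, the vertex `y` has exactly `c i`
neighbours at distance `i - 1` from `x` (none if `i = 0`) and exactly `b i` neighbours at distance
`i + 1` from `x`. The values of `b` and `c` beyond the diameter are irrelevant; the valency is
`b 0`. -/
structure SimpleGraph.IsDistanceRegularWith {V : Type*} (G : SimpleGraph V) (b c : ℕ → ℕ) :
    Prop where
  connected : G.Connected
  ncard_closer : ∀ (i : ℕ) (x y : V), G.dist x y = i →
    {z : V | G.Adj y z ∧ G.dist x z + 1 = i}.ncard = c i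
  ncard_farther : ∀ (i : ℕ) (x y : V), G.dist x y = i →
    {z : V | G.Adj y z ∧ G.dist x z = i + 1}.ncard = b i

/-!
Call `i` a jump if `c (i - 1) < c i`. At a jump `i`, double counting over the pairs of vertices at
distance `i` gives `c j + c (i - j) ≤ c i`. Between two jumps `c` is constant, so there
`C(z, y) = C(x, y)` whenever `z` lies on a geodesic from `x` to `y`, and geodesics can be retraced
from one to the other. If `c` were constant on `[q + 1, 3 * q]` after a jump at `q + 1`, this
would produce two overlapping geodesics of length `3 * q` with detours at both ends, for which
counting the neighbours of the midpoint yields a strict inequality that contradicts its own mirror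
image. Hence consecutive jumps are less than a factor `3` apart, and superadditivity at jumps makes
`c i` grow like a square root: `c t ^ 2 * i ≤ 6 * t * c i ^ 2` if `c t ≥ 2`. If `c t = 1`, then
`c (2 * t) ≥ 2`, since geodesics of length `2 * t` cannot all be unique when `2 * b t < b 0`, and
the bound follows from the one for `2 * t`. As `c (D - t) ≤ b t ≤ C * c t`, where `D` is the
diameter, this bounds `D - t` by `6 * C ^ 2 * t`.
-/

namespace DistanceRegular

variable {V : Type*} {G : SimpleGraph V} {x y z u v : V}

/-- `y` lies on a geodesic of `G` from `x` to `z`. Reducible, so that it is an equation for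
`omega` and `grind`. -/
abbrev IsBetween (G : SimpleGraph V) (x y z : V) : Prop :=
  G.dist x y + G.dist y z = G.dist x z

/-- The neighbours of `y` closer to `x` than `y` is, usually written `C(x, y)`. -/
def closerNeighbors (G : SimpleGraph V) (x y : V) : Set V :=
  {z | G.Adj y z ∧ G.dist x z + 1 = G.dist x y}

/-- The neighbours of `y` farther from `x` than `y` is, usually written `B(x, y)`. -/
def fartherNeighbors (G : SimpleGraph V) (x y : V) : Set V :=
  {z | G.Adj y z ∧ G.dist x z = G.dist x y + 1}

lemma IsBetween.symm (h : IsBetween G x y z) : IsBetween G z y x := by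
  grind [G.dist_comm]

lemma exists_isBetween_dist_eq (hG : G.Connected) (x y : V) {i : ℕ} (hi : i ≤ G.dist x y) :
    ∃ z, IsBetween G x z y ∧ G.dist x z = i := by
  obtain ⟨p, hp⟩ := hG.exists_walk_length_eq_dist x y
  have hleft := G.dist_le (p.take i)
  have hright := G.dist_le (p.drop i)
  have htri := hG.dist_triangle (u := x) (v := p.getVert i) (w := y)
  rw [SimpleGraph.Walk.take_length] at hleft
  rw [SimpleGraph.Walk.drop_length] at hright
  exact ⟨p.getVert i, by omega, by omega⟩

lemma closerNeighbors_nonempty (hG : G.Connected) (hxy : 0 < G.dist x y) :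
    (closerNeighbors G x y).Nonempty := by
  obtain ⟨z, hz, hxz⟩ := exists_isBetween_dist_eq hG x y (i := G.dist x y - 1) (by omega)
  have hzy : G.dist z y = 1 := by omega
  exact ⟨z, (SimpleGraph.dist_eq_one_iff_adj.1 hzy).symm, by omega⟩

lemma isBetween_of_mem_closerNeighbors (hz : z ∈ closerNeighbors G x y) : IsBetween G x z y := by
  rw [IsBetween, SimpleGraph.dist_eq_one_iff_adj.2 hz.1.symm, hz.2]

lemma IsBetween.closerNeighbors_subset (hG : G.Connected) (h : IsBetween G x z y) :
    closerNeighbors G z y ⊆ closerNeighbors G x y := by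
  rintro v ⟨hyv, hv⟩
  have htri := hG.dist_triangle (u := x) (v := z) (w := v)
  have hdiff := hyv.diff_dist_adj (u := x)
  exact ⟨hyv, by omega⟩

lemma IsBetween.closerNeighbors_subset_fartherNeighbors (hG : G.Connected)
    (h : IsBetween G x y z) : closerNeighbors G z y ⊆ fartherNeighbors G x y := by
  rintro v ⟨hyv, hv⟩
  have htri := hG.dist_triangle (u := x) (v := v) (w := z)
  have hdiff := hyv.diff_dist_adj (u := x)
  exact ⟨hyv, by grind [G.dist_comm]⟩

lemma mem_closerNeighbors_iff_mem_closerNeighbors (hu : u ∈ closerNeighbors G y x)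
    (hv : v ∈ closerNeighbors G x y) :
    v ∈ closerNeighbors G u y ↔ u ∈ closerNeighbors G v x := by
  simp only [closerNeighbors, Set.mem_ofPred_eq] at *
  grind [G.dist_comm]

lemma ncard_le_ncard_of_forall_rel {α β : Type*} [Finite α] [Finite β] {s : Set α} {t : Set β}
    (r : α → β → Prop) {m : ℕ} (hm : 0 < m) (hs : ∀ a ∈ s, m ≤ {b ∈ t | r a b}.ncard)
    (ht : ∀ b ∈ t, {a ∈ s | r a b}.ncard ≤ m) : s.ncard ≤ t.ncard := by
  classical
  lift s to Finset α using s.toFinite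
  lift t to Finset β using t.toFinite
  simp only [Finset.mem_coe, ← Finset.coe_filter, Set.ncard_coe_finset] at *
  exact Nat.le_of_mul_le_mul_right (Finset.card_mul_le_card_mul r hs ht) hm

lemma sq_mul_le_of_le_add {a l m n p r s t : ℕ} (hn : n ≤ l + m)
    (hl : a ^ 2 * l ≤ 2 * t * p ^ 2) (hm : a ^ 2 * m ≤ 6 * t * r ^ 2) (hrp : r ≤ p)
    (hs : p + r ≤ s) : a ^ 2 * n ≤ 2 * t * s ^ 2 :=
  calc a ^ 2 * n ≤ a ^ 2 * (l + m) := by gcongr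
    _ = a ^ 2 * l + a ^ 2 * m := by ring
    _ ≤ 2 * t * p ^ 2 + 6 * t * r ^ 2 := by gcongr
    _ = 2 * t * (p ^ 2 + 2 * r * r + r ^ 2) := by ring
    _ ≤ 2 * t * (p ^ 2 + 2 * p * r + r ^ 2) := by gcongr
    _ = 2 * t * (p + r) ^ 2 := by ring
    _ ≤ 2 * t * s ^ 2 := by gcongr

end DistanceRegular

namespace SimpleGraph.IsDistanceRegularWith

open DistanceRegular

variable {V : Type*} {G : SimpleGraph V} {b c : ℕ → ℕ} {x y z u v w : V} {i j q : ℕ}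

lemma ncard_closerNeighbors (hG : G.IsDistanceRegularWith b c) (x y : V) :
    (closerNeighbors G x y).ncard = c (G.dist x y) :=
  hG.ncard_closer _ x y rfl

lemma ncard_fartherNeighbors (hG : G.IsDistanceRegularWith b c) (x y : V) :
    (fartherNeighbors G x y).ncard = b (G.dist x y) :=
  hG.ncard_farther _ x y rfl

lemma c_zero (hG : G.IsDistanceRegularWith b c) : c 0 = 0 := by
  obtain ⟨x⟩ := hG.connected.nonempty
  simpa using (hG.ncard_closer 0 x x G.dist_self).symm

lemma exists_dist_eq (hG : G.IsDistanceRegularWith b c) (hi : i ≤ G.diam) :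
    ∃ x y, G.dist x y = i := by
  have := hG.connected.nonempty
  obtain ⟨x, y, hxy⟩ := G.exists_dist_eq_diam
  obtain ⟨z, -, hz⟩ := exists_isBetween_dist_eq hG.connected x y (hi.trans_eq hxy.symm)
  exact ⟨x, z, hz⟩

lemma c_one (hG : G.IsDistanceRegularWith b c) (hD : 1 ≤ G.diam) : c 1 = 1 := by
  obtain ⟨x, y, hxy⟩ := hG.exists_dist_eq hD
  have hsingleton : closerNeighbors G x y = {x} := by
    ext z
    rw [closerNeighbors, hxy, Set.mem_ofPred_eq, add_eq_right, hG.connected.dist_eq_zero_iff,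
      Set.mem_singleton_iff, eq_comm, and_iff_right_of_imp]
    rintro rfl
    exact (dist_eq_one_iff_adj.1 hxy).symm
  have hcard := hG.ncard_closerNeighbors x y
  rwa [hsingleton, Set.ncard_singleton, hxy, eq_comm] at hcard

variable [Finite V]

lemma dist_le_diam (hG : G.IsDistanceRegularWith b c) (x y : V) : G.dist x y ≤ G.diam :=
  have := hG.connected.nonempty
  SimpleGraph.dist_le_diam (connected_iff_ediam_ne_top.1 hG.connected)

lemma c_mono (hG : G.IsDistanceRegularWith b c) (hij : i ≤ j) (hj : j ≤ G.diam) :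
    c i ≤ c j := by
  obtain ⟨x, y, hxy⟩ := hG.exists_dist_eq hj
  obtain ⟨z, hz, hxz⟩ := exists_isBetween_dist_eq hG.connected x y (i := j - i) (by omega)
  have hsub := Set.ncard_le_ncard (hz.closerNeighbors_subset hG.connected)
  rwa [hG.ncard_closerNeighbors, hG.ncard_closerNeighbors, hxy,
    show G.dist z y = i by omega] at hsub

lemma c_le_b (hG : G.IsDistanceRegularWith b c) (hij : i + j ≤ G.diam) : c j ≤ b i := by
  obtain ⟨x, z, hxz⟩ := hG.exists_dist_eq hij
  obtain ⟨y, hy, hxy⟩ := exists_isBetween_dist_eq hG.connected x z (i := i) (by omega)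
  have hsub := Set.ncard_le_ncard (hy.closerNeighbors_subset_fartherNeighbors hG.connected)
  rwa [hG.ncard_closerNeighbors, hG.ncard_fartherNeighbors, hxy, G.dist_comm,
    show G.dist y z = j by omega] at hsub

lemma c_pos (hG : G.IsDistanceRegularWith b c) (hi : 1 ≤ i) (hiD : i ≤ G.diam) : 1 ≤ c i :=
  (hG.c_one (hi.trans hiD)).symm.trans_le (hG.c_mono hi hiD)

lemma exists_isBetween_extension (hG : G.IsDistanceRegularWith b c) (x y : V)
    (hi : G.dist x y + i ≤ G.diam) : ∃ z, IsBetween G x y z ∧ G.dist y z = i := by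
  induction i with
  | zero => exact ⟨y, by simp, by simp⟩
  | succ i ih =>
    obtain ⟨z, hz, hyz⟩ := ih (by omega)
    have hfarther : 0 < (fartherNeighbors G x z).ncard := by
      rw [hG.ncard_fartherNeighbors]
      exact (hG.c_pos le_rfl (by omega)).trans (hG.c_le_b (by omega))
    obtain ⟨w, hzw, hw⟩ := (Set.ncard_pos).1 hfarther
    have hdiff := hzw.diff_dist_adj (u := y)
    have htri := hG.connected.dist_triangle (u := x) (v := y) (w := w)
    exact ⟨w, by omega, by omega⟩

lemma closerNeighbors_eq (hG : G.IsDistanceRegularWith b c) (hz : IsBetween G x z y)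
    (hc : c (G.dist x y) ≤ c (G.dist z y)) : closerNeighbors G z y = closerNeighbors G x y :=
  Set.eq_of_subset_of_ncard_le (hz.closerNeighbors_subset hG.connected)
    (by rwa [hG.ncard_closerNeighbors, hG.ncard_closerNeighbors])

lemma ncard_closerNeighbors_sdiff (hG : G.IsDistanceRegularWith b c)
    (hu : u ∈ closerNeighbors G y x) :
    (closerNeighbors G x y \ closerNeighbors G u y).ncard =
      c (G.dist x y) - c (G.dist x y - 1) := by
  have hux := (isBetween_of_mem_closerNeighbors hu).symm
  have hdist : G.dist u y = G.dist x y - 1 := by grind [closerNeighbors, G.dist_comm]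
  rw [Set.ncard_sdiff (hux.closerNeighbors_subset hG.connected), hG.ncard_closerNeighbors,
    hG.ncard_closerNeighbors, hdist]

-- Double counting between `C(z, x)` and `C(x, y) \ C(z, y)`, where `z` is at distance `j` from `x`
-- on a geodesic from `x` to `y`: `u` and `v` are related if `v` is not on a geodesic from `y`
-- to `u`.
lemma c_add_c_le_of_jump (hG : G.IsDistanceRegularWith b c) (hi : i ≤ G.diam)
    (hjump : c (i - 1) < c i) {l : ℕ} (hjl : j + l = i) : c j + c l ≤ c i := by
  obtain ⟨x, y, rfl⟩ := hG.exists_dist_eq hi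
  obtain ⟨z, hz, hxz⟩ := exists_isBetween_dist_eq hG.connected x y (i := j) (by omega)
  have hzx : G.dist z x = j := by rw [G.dist_comm, hxz]
  have hzy : G.dist z y = l := by omega
  have hsub_y := hz.closerNeighbors_subset hG.connected
  have hsub_x := hz.symm.closerNeighbors_subset hG.connected
  suffices (closerNeighbors G z x).ncard ≤ (closerNeighbors G x y \ closerNeighbors G z y).ncard by
    have hle := hG.c_mono (show l ≤ G.dist x y by omega) hi
    rw [Set.ncard_sdiff hsub_y, hG.ncard_closerNeighbors, hG.ncard_closerNeighbors,
      hG.ncard_closerNeighbors, hzx, hzy] at this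
    omega
  refine ncard_le_ncard_of_forall_rel (fun u v => v ∉ closerNeighbors G u y)
    (Nat.sub_pos_of_lt hjump) (fun u hu => ?_) (fun v hv => ?_)
  · have huzy : IsBetween G u z y := by
      have hux := (hsub_x hu).2
      have huz := hu.2
      grind [G.dist_comm]
    rw [← hG.ncard_closerNeighbors_sdiff (hsub_x hu)]
    exact Set.ncard_le_ncard fun v ⟨hv, hvu⟩ =>
      ⟨⟨hv, fun h => hvu (huzy.closerNeighbors_subset hG.connected h)⟩, hvu⟩
  · rw [G.dist_comm, ← hG.ncard_closerNeighbors_sdiff hv.1]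
    exact Set.ncard_le_ncard fun u ⟨hu, hvu⟩ =>
      ⟨hsub_x hu, fun h =>
        hvu ((mem_closerNeighbors_iff_mem_closerNeighbors (hsub_x hu) hv.1).2 h)⟩

lemma dist_add_two_le_of_closerNeighbors_subset (hG : G.IsDistanceRegularWith b c)
    (hsub : closerNeighbors G x y ⊆ closerNeighbors G z y)
    (hc : c (G.dist z y) ≤ c (G.dist x y)) (hu : IsBetween G z u y) (huy : 0 < G.dist u y) :
    G.dist x u + 2 ≤ G.dist x y + G.dist u y := by
  have heq : closerNeighbors G x y = closerNeighbors G z y :=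
    Set.eq_of_subset_of_ncard_le hsub
      (by rwa [hG.ncard_closerNeighbors, hG.ncard_closerNeighbors])
  obtain ⟨r, hr⟩ := closerNeighbors_nonempty hG.connected huy
  have hrx : r ∈ closerNeighbors G x y := heq ▸ hu.closerNeighbors_subset hG.connected hr
  have htri := hG.connected.dist_triangle (u := x) (v := r) (w := u)
  grind [closerNeighbors, G.dist_comm]

-- Walk back along a geodesic from `w` to `y`: the distances of each of its vertices `v` from `z`
-- and from `x` are on the plateau of `c`, so `C(x, v) = C(z, v)` contains the next vertex.
lemma isBetween_of_plateau (hG : G.IsDistanceRegularWith b c)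
    (hc : c (G.dist z w) ≤ c (q + 1)) (hx : IsBetween G z x w) (hy : IsBetween G z y w)
    (hxy : G.dist z x + q ≤ G.dist z y) : IsBetween G z x y := by
  obtain ⟨n, hn⟩ : ∃ n, G.dist y w = n := ⟨_, rfl⟩
  induction n generalizing y with
  | zero =>
    obtain rfl := hG.connected.dist_eq_zero_iff.1 hn
    exact hx
  | succ n ih =>
    obtain ⟨y', hy'w, hy'⟩ := closerNeighbors_nonempty hG.connected (x := w) (y := y)
      (by grind [G.dist_comm])
    have htri := hG.connected.dist_triangle (u := z) (v := y') (w := w)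
    have hdiff := hy'w.diff_dist_adj (u := z)
    have hxy' : IsBetween G z x y' :=
      ih (by grind [G.dist_comm]) (by grind [G.dist_comm]) (by grind [G.dist_comm])
    have heq : closerNeighbors G x y' = closerNeighbors G z y' :=
      hG.closerNeighbors_eq hxy' <|
        calc c (G.dist z y') ≤ c (G.dist z w) :=
              hG.c_mono (by grind [G.dist_comm]) (hG.dist_le_diam z w)
          _ ≤ c (q + 1) := hc
          _ ≤ c (G.dist x y') := hG.c_mono (by grind [G.dist_comm]) (hG.dist_le_diam x y')
    have hmem : y ∈ closerNeighbors G x y' := heq ▸ ⟨hy'w.symm, by grind [G.dist_comm]⟩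
    grind [closerNeighbors, G.dist_comm]

lemma dist_le_of_plateau (hG : G.IsDistanceRegularWith b c) (hq : 1 ≤ q)
    (hc : c (G.dist z w) ≤ c (q + 1)) (hx : IsBetween G z x w) (hy : IsBetween G z y w)
    (hqx : q + 1 ≤ G.dist z x) (hxy : G.dist z y + 1 = G.dist z x + q)
    (hyw : G.dist z y < G.dist z w) : G.dist x y ≤ q := by
  by_contra! hlt
  obtain ⟨y', hyy', hy'⟩ := closerNeighbors_nonempty hG.connected (x := w) (y := y)
    (by grind [G.dist_comm])
  have htri := hG.connected.dist_triangle (u := z) (v := y') (w := w)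
  have hdiff_z := hyy'.diff_dist_adj (u := z)
  have hdiff_x := hyy'.diff_dist_adj (u := x)
  have hdist := dist_eq_one_iff_adj.2 hyy'
  have hxy' : IsBetween G z x y' :=
    hG.isBetween_of_plateau hc hx (by grind [G.dist_comm]) (by grind [G.dist_comm])
  have hyx : G.dist y x = q + 1 := by grind [G.dist_comm]
  have hsub : closerNeighbors G z x ⊆ closerNeighbors G y x := by
    rintro r ⟨hxr, hr⟩
    have htri_r := hG.connected.dist_triangle (u := z) (v := r) (w := w)
    have hdiff_w := hxr.diff_dist_adj (u := w)
    have hry : IsBetween G z r y :=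
      hG.isBetween_of_plateau hc (by grind [G.dist_comm]) hy (by omega)
    exact ⟨hxr, by grind [G.dist_comm]⟩
  have hle := hG.dist_add_two_le_of_closerNeighbors_subset hsub (u := y')
    (by rw [hyx]; exact hG.c_mono hqx (hG.dist_le_diam z x))
    (by grind [G.dist_comm]) (by grind [G.dist_comm])
  grind [G.dist_comm]

lemma lt_dist_of_plateau (hG : G.IsDistanceRegularWith b c) (hq : 1 ≤ q)
    (hD : 2 * q + 1 ≤ G.diam) (hc : c (2 * q + 1) ≤ c (q + 1)) (hxy : G.dist x y = q)
    (hu : u ∈ fartherNeighbors G y x) (hv : v ∈ fartherNeighbors G x y) : q < G.dist u v := by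
  by_contra! hle
  obtain ⟨hxu, hyu⟩ := hu
  obtain ⟨hyv, hxv⟩ := hv
  have hdiff_u := hyv.diff_dist_adj (u := u)
  obtain ⟨e, hve, hxe⟩ := hG.exists_isBetween_extension x v (i := q) (by omega)
  have hev : closerNeighbors G v x = closerNeighbors G e x :=
    hG.closerNeighbors_eq hve.symm (by grind [G.dist_comm])
  have hue : u ∈ closerNeighbors G e x := hev ▸ ⟨hxu, by grind [G.dist_comm]⟩
  have hdiff_e := hyv.diff_dist_adj (u := e)
  have htri := hG.connected.dist_triangle (u := x) (v := y) (w := e)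
  have hdist := dist_eq_one_iff_adj.2 hxu
  have hye : G.dist e y = q + 1 := by grind [G.dist_comm]
  have hsub : closerNeighbors G e y ⊆ closerNeighbors G u y := by
    rintro r ⟨hyr, hr⟩
    have hdiff_r := hyr.diff_dist_adj (u := x)
    have htri_r := hG.connected.dist_triangle (u := x) (v := r) (w := e)
    have hur : IsBetween G x u r := hG.isBetween_of_plateau (w := e) (q := q)
      (by grind [G.dist_comm]) (isBetween_of_mem_closerNeighbors hue).symm
      (by grind [G.dist_comm]) (by grind [G.dist_comm])
    exact ⟨hyr, by grind [G.dist_comm]⟩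
  have hle' := hG.dist_add_two_le_of_closerNeighbors_subset hsub (u := x)
    (by grind [G.dist_comm]) (by grind [G.dist_comm]) (by omega)
  grind [G.dist_comm]

end SimpleGraph.IsDistanceRegularWith

namespace DistanceRegular

/-- Two overlapping geodesics `x₀ x₁ x₂ x₃` and `x₁ x₂ x₃ x₄`, whose named vertices are `q` apart,
together with a neighbour `y₃ ∈ C(x₀, x₃) \ C(x₂, x₃)` of `x₃` and a neighbour
`y₁ ∈ C(x₄, x₁) \ C(x₂, x₁)` of `x₁`. It exists whenever `c q < c (3 * q)`, and is contradictory
if `c` is constant on `[q + 1, 3 * q]`. -/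
structure DetourConfig {V : Type*} (G : SimpleGraph V) (q : ℕ) (x₀ x₁ x₂ x₃ x₄ y₁ y₃ : V) :
    Prop where
  dist_x₀_x₁ : G.dist x₀ x₁ = q
  dist_x₁_x₂ : G.dist x₁ x₂ = q
  dist_x₂_x₃ : G.dist x₂ x₃ = q
  dist_x₃_x₄ : G.dist x₃ x₄ = q
  dist_x₀_x₃ : G.dist x₀ x₃ = 3 * q
  dist_x₁_x₄ : G.dist x₁ x₄ = 3 * q
  y₃_mem : y₃ ∈ closerNeighbors G x₀ x₃
  y₃_notMem : y₃ ∉ closerNeighbors G x₂ x₃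
  y₁_mem : y₁ ∈ closerNeighbors G x₄ x₁
  y₁_notMem : y₁ ∉ closerNeighbors G x₂ x₁

namespace DetourConfig

variable {V : Type*} {G : SimpleGraph V} {b c : ℕ → ℕ} {q : ℕ} {x₀ x₁ x₂ x₃ x₄ y₁ y₃ g p : V}

lemma symm (h : DetourConfig G q x₀ x₁ x₂ x₃ x₄ y₁ y₃) :
    DetourConfig G q x₄ x₃ x₂ x₁ x₀ y₃ y₁ where
  dist_x₀_x₁ := G.dist_comm.trans h.dist_x₃_x₄
  dist_x₁_x₂ := G.dist_comm.trans h.dist_x₂_x₃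
  dist_x₂_x₃ := G.dist_comm.trans h.dist_x₁_x₂
  dist_x₃_x₄ := G.dist_comm.trans h.dist_x₀_x₁
  dist_x₀_x₃ := G.dist_comm.trans h.dist_x₁_x₄
  dist_x₁_x₄ := G.dist_comm.trans h.dist_x₀_x₃
  y₃_mem := h.y₁_mem
  y₃_notMem := h.y₁_notMem
  y₁_mem := h.y₃_mem
  y₁_notMem := h.y₃_notMem

lemma one_le (h : DetourConfig G q x₀ x₁ x₂ x₃ x₄ y₁ y₃) : 1 ≤ q := by
  have hy₃ := h.y₃_mem.2
  rw [h.dist_x₀_x₃] at hy₃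
  omega

lemma dist_x₀_x₂ (h : DetourConfig G q x₀ x₁ x₂ x₃ x₄ y₁ y₃) (hconn : G.Connected) :
    G.dist x₀ x₂ = 2 * q := by
  have htri := hconn.dist_triangle (u := x₀) (v := x₁) (w := x₂)
  have htri' := hconn.dist_triangle (u := x₀) (v := x₂) (w := x₃)
  grind [h.dist_x₀_x₁, h.dist_x₁_x₂, h.dist_x₂_x₃, h.dist_x₀_x₃]

lemma dist_x₁_x₃ (h : DetourConfig G q x₀ x₁ x₂ x₃ x₄ y₁ y₃) (hconn : G.Connected) :
    G.dist x₁ x₃ = 2 * q := by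
  have htri := hconn.dist_triangle (u := x₁) (v := x₂) (w := x₃)
  have htri' := hconn.dist_triangle (u := x₀) (v := x₁) (w := x₃)
  grind [h.dist_x₀_x₁, h.dist_x₁_x₂, h.dist_x₂_x₃, h.dist_x₀_x₃]

variable [Finite V]

lemma dist_x₁_y₃ (h : DetourConfig G q x₀ x₁ x₂ x₃ x₄ y₁ y₃) (hG : G.IsDistanceRegularWith b c)
    (hc : c (3 * q) ≤ c (q + 1)) : G.dist x₁ y₃ + 1 = 2 * q := by
  have hx₁y₃ : IsBetween G x₀ x₁ y₃ := hG.isBetween_of_plateau (w := x₃) (q := q)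
    (by rwa [h.dist_x₀_x₃])
    (by grind [h.dist_x₀_x₁, h.dist_x₁_x₃ hG.connected, h.dist_x₀_x₃])
    (isBetween_of_mem_closerNeighbors h.y₃_mem)
    (by grind [h.dist_x₀_x₁, h.dist_x₀_x₃, h.y₃_mem.2, h.one_le])
  grind [h.dist_x₀_x₁, h.dist_x₀_x₃, h.y₃_mem.2]

lemma dist_x₀_y₁ (h : DetourConfig G q x₀ x₁ x₂ x₃ x₄ y₁ y₃) (hG : G.IsDistanceRegularWith b c)
    (hc : c (3 * q) ≤ c (q + 1)) : G.dist x₀ y₁ = q + 1 := by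
  have hdiff := h.y₁_mem.1.diff_dist_adj (u := x₀)
  have htri := hG.connected.dist_triangle (u := x₀) (v := y₁) (w := x₃)
  grind [G.dist_comm, h.dist_x₀_x₁, h.dist_x₀_x₃, h.symm.dist_x₁_y₃ hG hc]

lemma dist_x₂_y₃ (h : DetourConfig G q x₀ x₁ x₂ x₃ x₄ y₁ y₃) (hG : G.IsDistanceRegularWith b c)
    (hc : c (3 * q) ≤ c (q + 1)) : G.dist x₂ y₃ = q := by
  have hx₂ := h.dist_x₀_x₂ hG.connected
  have hx₃ := h.dist_x₀_x₃
  have hx₂₃ := h.dist_x₂_x₃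
  have hy₃ := h.y₃_mem.2
  have hq := h.one_le
  have hle : G.dist x₂ y₃ ≤ q := hG.dist_le_of_plateau (z := x₀) (w := x₃) hq (by rwa [hx₃])
    (by omega) (isBetween_of_mem_closerNeighbors h.y₃_mem) (by omega) (by omega) (by omega)
  have hdiff := h.y₃_mem.1.diff_dist_adj (u := x₂)
  have hne : G.dist x₂ y₃ + 1 ≠ G.dist x₂ x₃ := fun heq => h.y₃_notMem ⟨h.y₃_mem.1, heq⟩
  omega

lemma dist_eq_of_adj (h : DetourConfig G q x₀ x₁ x₂ x₃ x₄ y₁ y₃)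
    (hG : G.IsDistanceRegularWith b c) (hc : c (3 * q) ≤ c (q + 1)) (hg : G.Adj x₂ g)
    (hx₁ : G.dist x₁ g ≤ q) (hy₃ : G.dist y₃ g = q + 1) :
    G.dist x₀ g = 2 * q ∧ G.dist x₃ g = q + 1 := by
  have hx₀₃ := h.dist_x₀_x₃
  have hx₂₃ := h.dist_x₂_x₃
  have hx₀y₃ := h.y₃_mem.2
  have hbetween := isBetween_of_mem_closerNeighbors h.y₃_mem
  have hq := h.one_le
  have htri := hG.connected.dist_triangle (u := x₀) (v := x₁) (w := g)
  have htri' := hG.connected.dist_triangle (u := x₀) (v := g) (w := x₃)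
  have hdiff₃ := hg.diff_dist_adj (u := x₃)
  have hx₀g : G.dist x₀ g = 2 * q := by
    by_contra hne
    have hgy₃ : IsBetween G x₀ g y₃ := hG.isBetween_of_plateau (w := x₃) (q := q) (by rwa [hx₀₃])
      (by grind [G.dist_comm, h.dist_x₀_x₁]) hbetween (by grind [h.dist_x₀_x₁])
    grind [G.dist_comm, h.dist_x₀_x₁]
  refine ⟨hx₀g, ?_⟩
  by_contra hne
  have hgy₃ : G.dist g y₃ ≤ q := hG.dist_le_of_plateau (z := x₀) (w := x₃) hq (by rwa [hx₀₃])
    (by grind [G.dist_comm]) hbetween (by omega) (by omega) (by omega)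
  grind [G.dist_comm]

lemma exists_dist_eq_of_adj (h : DetourConfig G q x₀ x₁ x₂ x₃ x₄ y₁ y₃)
    (hG : G.IsDistanceRegularWith b c) (hc : c (3 * q) ≤ c (q + 1)) (hg : G.Adj x₂ g)
    (hx₁ : G.dist x₁ g ≤ q) (hy₃ : G.dist y₃ g = q + 1) :
    ∃ e, G.dist x₀ e = 3 * q ∧ G.dist x₂ e = q ∧ G.dist g e = q := by
  obtain ⟨hx₀g, hx₃g⟩ := h.dist_eq_of_adj hG hc hg hx₁ hy₃
  have hx₀₃ := h.dist_x₀_x₃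
  have hgx₃ : G.dist g x₃ = q + 1 := by rw [G.dist_comm, hx₃g]
  have hq := h.one_le
  have hdiam : 3 * q ≤ G.diam := hx₀₃ ▸ hG.dist_le_diam x₀ x₃
  have hcards : (closerNeighbors G x₀ x₃).ncard ≤ (closerNeighbors G g x₃).ncard := by
    rwa [hG.ncard_closerNeighbors, hG.ncard_closerNeighbors, hx₀₃, hgx₃]
  have hy₃_notMem : y₃ ∉ closerNeighbors G g x₃ := fun hmem => by
    grind [closerNeighbors, G.dist_comm]
  obtain ⟨e, ⟨hx₃e, hge⟩, he⟩ : ∃ e ∈ closerNeighbors G g x₃, e ∉ closerNeighbors G x₀ x₃ := by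
    by_contra! hsub
    exact hy₃_notMem (Set.eq_of_subset_of_ncard_le hsub hcards ▸ h.y₃_mem)
  have hx₀e : G.dist x₀ e + 1 ≠ G.dist x₀ x₃ := fun heq => he ⟨hx₃e, heq⟩
  have hdiff₀ := hx₃e.diff_dist_adj (u := x₀)
  have hdiff₂ := hx₃e.diff_dist_adj (u := x₂)
  have htri := hG.connected.dist_triangle (u := x₀) (v := g) (w := e)
  have htri' := hG.connected.dist_triangle (u := x₀) (v := x₂) (w := e)
  have hx₀₂ := h.dist_x₀_x₂ hG.connected
  have hx₂₃ := h.dist_x₂_x₃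
  refine ⟨e, by omega, ?_, by omega⟩
  by_contra hne
  have hlt : q < G.dist g e := hG.lt_dist_of_plateau hq (by omega)
    ((hG.c_mono (by omega) hdiam).trans hc) hx₂₃ ⟨hg, by grind [G.dist_comm]⟩
    ⟨hx₃e, by omega⟩
  omega

lemma dist_y₁_le_of_adj (h : DetourConfig G q x₀ x₁ x₂ x₃ x₄ y₁ y₃)
    (hG : G.IsDistanceRegularWith b c) (hc : c (3 * q) ≤ c (q + 1)) (hg : G.Adj x₂ g)
    (hx₁ : G.dist x₁ g ≤ q) (hy₃ : G.dist y₃ g = q + 1) : G.dist y₁ g ≤ q := by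
  by_contra! hlt
  obtain ⟨hx₀g, hx₃g⟩ := h.dist_eq_of_adj hG hc hg hx₁ hy₃
  obtain ⟨e, hx₀e, hx₂e, hge⟩ := h.exists_dist_eq_of_adj hG hc hg hx₁ hy₃
  have hx₀₂ := h.dist_x₀_x₂ hG.connected
  have hx₀₃ := h.dist_x₀_x₃
  have hx₂₃ := h.dist_x₂_x₃
  have hx₀y₁ := h.dist_x₀_y₁ hG hc
  have hx₃y₁ := h.symm.dist_x₁_y₃ hG hc
  have hx₂y₁ := h.symm.dist_x₂_y₃ hG hc
  have hdiff := hg.diff_dist_adj (u := y₁)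
  have hgy₁ : G.dist g y₁ = q + 1 := by grind [G.dist_comm]
  have hsub : closerNeighbors G x₀ y₁ ⊆ closerNeighbors G g y₁ := by
    rintro p ⟨hy₁p, hp⟩
    have hdiff₃ := hy₁p.diff_dist_adj (u := x₃)
    have htri₃ := hG.connected.dist_triangle (u := x₀) (v := p) (w := x₃)
    have hpx₂ : IsBetween G x₀ p x₂ := hG.isBetween_of_plateau (w := x₃) (q := q)
      (by rwa [hx₀₃]) (by grind [G.dist_comm]) (by omega) (by omega)
    have htri_p := hG.connected.dist_triangle (u := p) (v := x₂) (w := e)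
    have htri_e := hG.connected.dist_triangle (u := x₀) (v := p) (w := e)
    have hpg : IsBetween G x₀ p g := hG.isBetween_of_plateau (w := e) (q := q)
      (by rwa [hx₀e]) (by omega) (by omega) (by omega)
    exact ⟨hy₁p, by grind [G.dist_comm]⟩
  have hle := hG.dist_add_two_le_of_closerNeighbors_subset hsub (u := x₂)
    (by rw [hx₀y₁, hgy₁])
    (by grind [G.dist_comm, SimpleGraph.dist_eq_one_iff_adj.2 hg])
    (by rw [hx₂y₁]; exact h.one_le)
  grind [h.one_le]

lemma dist_of_mem_closerNeighbors (h : DetourConfig G q x₀ x₁ x₂ x₃ x₄ y₁ y₃)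
    (hG : G.IsDistanceRegularWith b c) (hc : c (3 * q) ≤ c (q + 1))
    (hg : g ∈ closerNeighbors G x₃ x₂) :
    G.dist x₁ g = q + 1 ∧ G.dist y₁ g ≤ q ∧ G.dist y₃ g ≤ q := by
  obtain ⟨hx₂g, hx₃g⟩ := hg
  have hx₀₁ := h.dist_x₀_x₁
  have hx₁₂ := h.dist_x₁_x₂
  have hx₂₃ := h.dist_x₂_x₃
  have hx₀₃ := h.dist_x₀_x₃
  have hx₀y₁ := h.dist_x₀_y₁ hG hc
  have hx₃y₁ := h.symm.dist_x₁_y₃ hG hc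
  have hdiff₁ := hx₂g.diff_dist_adj (u := x₁)
  have htri_x₁ := hG.connected.dist_triangle (u := x₀) (v := x₁) (w := g)
  have htri_g := hG.connected.dist_triangle (u := x₀) (v := g) (w := x₃)
  have htri_x₃ := hG.connected.dist_triangle (u := y₃) (v := x₃) (w := g)
  have hx₃y₃ := SimpleGraph.dist_eq_one_iff_adj.2 h.y₃_mem.1
  have hy₁g : IsBetween G x₀ y₁ g := hG.isBetween_of_plateau (w := x₃) (q := q)
    (by rwa [hx₀₃]) (by grind [G.dist_comm]) (by grind [G.dist_comm]) (by grind [G.dist_comm])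
  exact ⟨by grind [G.dist_comm], by grind [G.dist_comm], by grind [G.dist_comm]⟩

lemma ncard_sdiff_lt (h : DetourConfig G q x₀ x₁ x₂ x₃ x₄ y₁ y₃)
    (hG : G.IsDistanceRegularWith b c) (hc : c (3 * q) ≤ c (q + 1)) :
    (fartherNeighbors G y₃ x₂ \ fartherNeighbors G x₁ x₂).ncard <
      (fartherNeighbors G y₁ x₂ \ fartherNeighbors G x₃ x₂).ncard := by
  have hx₁ := h.dist_x₁_x₂
  have hx₃ := h.symm.dist_x₁_x₂
  have hy₁ : G.dist y₁ x₂ = q := G.dist_comm.trans (h.symm.dist_x₂_y₃ hG hc)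
  have hy₃ : G.dist y₃ x₂ = q := G.dist_comm.trans (h.dist_x₂_y₃ hG hc)
  have hcard : (fartherNeighbors G x₃ x₂).ncard = (fartherNeighbors G y₁ x₂).ncard := by
    rw [hG.ncard_fartherNeighbors, hG.ncard_fartherNeighbors, hx₃, hy₁]
  rw [← (Set.ncard_eq_ncard_iff_ncard_sdiff_eq_ncard_sdiff).1 hcard]
  refine Set.ncard_lt_ncard (Set.ssubset_iff_exists.2 ⟨?_, ?_⟩)
  · rintro g ⟨⟨hg, hy₃g⟩, hx₁g⟩
    have hdiff := hg.diff_dist_adj (u := x₁)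
    have hne : G.dist x₁ g ≠ G.dist x₁ x₂ + 1 := fun heq => hx₁g ⟨hg, heq⟩
    have hx₁g_le : G.dist x₁ g ≤ q := by omega
    rw [hy₃] at hy₃g
    have hx₃g := (h.dist_eq_of_adj hG hc hg hx₁g_le hy₃g).2
    have hy₁g := h.dist_y₁_le_of_adj hG hc hg hx₁g_le hy₃g
    exact ⟨⟨hg, by omega⟩, fun hmem => by grind [hmem.2]⟩
  · obtain ⟨g, hg⟩ := closerNeighbors_nonempty hG.connected (x := x₁) (y := x₂)
      (hx₁ ▸ h.one_le)
    obtain ⟨hx₃g, hy₃g, hy₁g⟩ := h.symm.dist_of_mem_closerNeighbors hG hc hg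
    exact ⟨g, ⟨⟨hg.1, by omega⟩, fun hmem => by grind [hmem.2]⟩,
      fun hmem => by grind [hmem.1.2]⟩

end DetourConfig

end DistanceRegular

namespace SimpleGraph.IsDistanceRegularWith

open DistanceRegular

variable {V : Type*} [Finite V] {G : SimpleGraph V} {b c : ℕ → ℕ} {i q t : ℕ}

lemma exists_detourConfig (hG : G.IsDistanceRegularWith b c) (hD : 3 * q ≤ G.diam)
    (hjump : c q < c (3 * q)) :
    ∃ x₀ x₁ x₂ x₃ x₄ y₁ y₃, DetourConfig G q x₀ x₁ x₂ x₃ x₄ y₁ y₃ := by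
  obtain ⟨x₀, x₃, hx₀₃⟩ := hG.exists_dist_eq hD
  obtain ⟨x₁, hx₁, hx₀₁⟩ := exists_isBetween_dist_eq hG.connected x₀ x₃ (i := q) (by omega)
  obtain ⟨x₂, hx₂, hx₁₂⟩ := exists_isBetween_dist_eq hG.connected x₁ x₃ (i := q) (by omega)
  obtain ⟨x₄, hx₄, hx₃₄⟩ := hG.exists_isBetween_extension x₁ x₃ (i := q) (by omega)
  have hx₂₃ : G.dist x₂ x₃ = q := by omega
  have hx₁₄ : G.dist x₁ x₄ = 3 * q := by omega
  obtain ⟨y₃, hy₃, hy₃'⟩ := Set.exists_mem_notMem_of_ncard_lt_ncard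
    (s := closerNeighbors G x₂ x₃) (t := closerNeighbors G x₀ x₃)
    (by rwa [hG.ncard_closerNeighbors, hG.ncard_closerNeighbors, hx₀₃, hx₂₃])
  obtain ⟨y₁, hy₁, hy₁'⟩ := Set.exists_mem_notMem_of_ncard_lt_ncard
    (s := closerNeighbors G x₂ x₁) (t := closerNeighbors G x₄ x₁)
    (by rwa [hG.ncard_closerNeighbors, hG.ncard_closerNeighbors, G.dist_comm, hx₁₂,
      G.dist_comm, hx₁₄])
  exact ⟨x₀, x₁, x₂, x₃, x₄, y₁, y₃, hx₀₁, hx₁₂, hx₂₃, hx₃₄, hx₀₃, hx₁₄, hy₃, hy₃', hy₁, hy₁'⟩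

lemma c_lt_c_three_mul (hG : G.IsDistanceRegularWith b c) (hq : 1 ≤ q)
    (hD : 3 * q ≤ G.diam) (hjump : c q < c (q + 1)) : c (q + 1) < c (3 * q) := by
  by_contra! hc
  obtain ⟨x₀, x₁, x₂, x₃, x₄, y₁, y₃, h⟩ :=
    hG.exists_detourConfig hD (hjump.trans_le (hG.c_mono (by omega) hD))
  exact lt_asymm (h.ncard_sdiff_lt hG hc) (h.symm.ncard_sdiff_lt hG hc)

lemma exists_last_jump (hG : G.IsDistanceRegularWith b c) (hi : i ≤ G.diam) (hci : 2 ≤ c i) :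
    ∃ j ≤ i, c (j - 1) < c j ∧ c j = c i ∧ i < 3 * j := by
  classical
  have hi₀ : i ≠ 0 := by rintro rfl; grind [hG.c_zero]
  have hex : ∃ j, c j = c i := ⟨i, rfl⟩
  obtain ⟨j, hj, hmin⟩ : ∃ j, c j = c i ∧ ∀ l < j, c l ≠ c i :=
    ⟨Nat.find hex, Nat.find_spec hex, fun l hl => Nat.find_min hex hl⟩
  have hji : j ≤ i := not_lt.1 fun hij => hmin i hij rfl
  have hj₂ : 2 ≤ j := by
    by_contra! hj_lt
    have hle := hG.c_mono (i := j) (j := 1) (by omega) (by omega)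
    have hone := hG.c_one (by omega)
    omega
  have hjump : c (j - 1) < c j :=
    (hG.c_mono (by omega) (hji.trans hi)).lt_of_ne (hj ▸ hmin (j - 1) (by omega))
  refine ⟨j, hji, hjump, hj, ?_⟩
  by_contra! hle
  have hlt := hG.c_lt_c_three_mul (q := j - 1) (by omega) (by omega)
    (by rwa [Nat.sub_add_cancel (by omega)])
  have hmono := hG.c_mono (i := 3 * (j - 1)) (j := i) (by omega) hi
  rw [Nat.sub_add_cancel (by omega)] at hlt
  omega

lemma sq_mul_le_of_forall_jump (hG : G.IsDistanceRegularWith b c) (hct : 2 ≤ c t) (hti : t ≤ i)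
    (hi : i ≤ G.diam)
    (hjump : ∀ j ≤ i, c (j - 1) < c j → c t ≤ c j → c t ^ 2 * j ≤ 2 * t * c j ^ 2) :
    c t ^ 2 * i ≤ 6 * t * c i ^ 2 := by
  have hmono := hG.c_mono hti hi
  obtain ⟨j, hji, hj, hci, hij⟩ := hG.exists_last_jump hi (hct.trans hmono)
  calc c t ^ 2 * i ≤ c t ^ 2 * (3 * j) := by gcongr
    _ = 3 * (c t ^ 2 * j) := by ring
    _ ≤ 3 * (2 * t * c j ^ 2) := Nat.mul_le_mul_left 3 (hjump j hji hj (hci ▸ hmono))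
    _ = 6 * t * c i ^ 2 := by rw [hci]; ring

-- Superadditivity is applied to `i = (i - t) + t` if the last jump `j` up to `i - t` is close to
-- `i`, and to `i = j + (i - j)` otherwise.
lemma sq_mul_le_of_jump (hG : G.IsDistanceRegularWith b c) (ht : 1 ≤ t) (hct : 2 ≤ c t)
    (hi : i ≤ G.diam) (hjump : c (i - 1) < c i) (hci : c t ≤ c i) :
    c t ^ 2 * i ≤ 2 * t * c i ^ 2 := by
  induction i using Nat.strong_induction_on with
  | _ i ih =>
    obtain hi_le | hi_lt := le_or_gt i (2 * t)
    · calc c t ^ 2 * i ≤ c i ^ 2 * (2 * t) := by gcongr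
        _ = 2 * t * c i ^ 2 := by ring
    have hct_le : c t ≤ c (i - t) := hG.c_mono (by omega) (by omega)
    obtain ⟨j, hji, hj, hcj, hij⟩ :=
      hG.exists_last_jump (i := i - t) (by omega) (hct.trans hct_le)
    rw [← hcj] at hct_le
    have ihj := ih j (by omega) (by omega) hj hct_le
    obtain hclose | hfar := le_or_gt i (j + 2 * t)
    · have hX := hG.c_add_c_le_of_jump (j := i - t) (l := t) hi hjump (by omega)
      exact sq_mul_le_of_le_add hclose ihj (by grind) hct_le (hcj ▸ hX)
    have hX := hG.c_add_c_le_of_jump (j := j) (l := i - j) hi hjump (by omega)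
    obtain hsmall | hlarge := le_or_gt (i - j) j
    · have hm := hG.sq_mul_le_of_forall_jump (i := i - j) hct (by omega) (by omega)
        fun l hl => ih l (by omega) (by omega)
      exact sq_mul_le_of_le_add (m := i - j) (by omega) ihj hm (hG.c_mono hsmall (by omega)) hX
    · have hX' := hG.c_mono hlarge.le (by omega)
      have hm : c t ^ 2 * (i - j) ≤ 6 * t * c j ^ 2 :=
        calc c t ^ 2 * (i - j) ≤ c t ^ 2 * (2 * j + t) := by gcongr; omega
          _ = 2 * (c t ^ 2 * j) + t * c t ^ 2 := by ring
          _ ≤ 2 * (2 * t * c j ^ 2) + t * c j ^ 2 := by gcongr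
          _ ≤ 6 * t * c j ^ 2 := by linarith [Nat.zero_le (t * c j ^ 2)]
      exact sq_mul_le_of_le_add (m := i - j) (by omega) ihj hm le_rfl (by omega)

lemma sq_mul_le (hG : G.IsDistanceRegularWith b c) (ht : 1 ≤ t) (hct : 2 ≤ c t)
    (hti : t ≤ i) (hi : i ≤ G.diam) : c t ^ 2 * i ≤ 6 * t * c i ^ 2 :=
  hG.sq_mul_le_of_forall_jump hct hti hi fun _ hj => hG.sq_mul_le_of_jump ht hct (hj.trans hi)

lemma two_le_c_two_mul (hG : G.IsDistanceRegularWith b c) (ht : 1 ≤ t) (hD : 2 * t ≤ G.diam)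
    (hbt : 2 * b t < b 0) : 2 ≤ c (2 * t) := by
  by_contra! hlt
  obtain ⟨x, w, hxw⟩ := hG.exists_dist_eq hD
  obtain ⟨y, hy, hxy⟩ := exists_isBetween_dist_eq hG.connected x w (i := t) (by omega)
  have hwy : G.dist w y = t := by grind [G.dist_comm]
  have hcard : (fartherNeighbors G x y ∪ fartherNeighbors G w y).ncard <
      (fartherNeighbors G y y).ncard :=
    (Set.ncard_union_le _ _).trans_lt <| by
      simp only [hG.ncard_fartherNeighbors, G.dist_self, hxy, hwy]
      omega
  obtain ⟨z, hz, hz_notMem⟩ := Set.exists_mem_notMem_of_ncard_lt_ncard hcard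
  have hyz := hz.1
  rw [Set.mem_union, not_or] at hz_notMem
  have hxz : G.dist x z ≠ G.dist x y + 1 := fun heq => hz_notMem.1 ⟨hyz, heq⟩
  have hwz : G.dist w z ≠ G.dist w y + 1 := fun heq => hz_notMem.2 ⟨hyz, heq⟩
  have hdiff_x := hyz.diff_dist_adj (u := x)
  have hdiff_w := hyz.diff_dist_adj (u := w)
  have htri := hG.connected.dist_triangle (u := x) (v := z) (w := w)
  -- For `q = 0`, retracing says that geodesics of length `2 * t` are unique if `c (2 * t) = 1`.
  have hxyz : IsBetween G x y z := hG.isBetween_of_plateau (w := w) (q := 0)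
    (by rw [hxw, zero_add, hG.c_one (by omega)]; omega) hy
    (by grind [G.dist_comm]) (by grind [G.dist_comm])
  have hdist := dist_eq_one_iff_adj.2 hyz
  grind [G.dist_comm]

lemma sq_mul_le_of_two_mul_b_lt (hG : G.IsDistanceRegularWith b c) (ht : 1 ≤ t)
    (hbt : 2 * b t < b 0 * c t) (hti : 2 * t ≤ i) (hi : i ≤ G.diam) :
    c t ^ 2 * i ≤ 6 * t * c i ^ 2 := by
  have hct := hG.c_pos ht (by omega)
  obtain hct_eq | hct_ge : c t = 1 ∨ 2 ≤ c t := by omega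
  · have hc2t := hG.two_le_c_two_mul ht (hti.trans hi) (by rwa [hct_eq, mul_one] at hbt)
    have hle := hG.sq_mul_le (by omega) hc2t hti hi
    have hfour : 2 ^ 2 * i ≤ c (2 * t) ^ 2 * i := by gcongr
    rw [hct_eq]
    linarith
  · exact hG.sq_mul_le ht hct_ge (by omega) hi

lemma diam_le_of_b_le_mul_c (hG : G.IsDistanceRegularWith b c) (ht : 1 ≤ t)
    (hbt : 2 * b t < b 0 * c t) (hD : 3 * t ≤ G.diam) {C : ℝ} (hC : (b t : ℝ) ≤ C * c t) :
    (G.diam : ℝ) ≤ (6 * C ^ 2 + 1) * t := by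
  obtain ⟨i, hi⟩ : ∃ i, G.diam = t + i := ⟨G.diam - t, by omega⟩
  have hct : (0 : ℝ) < c t := mod_cast hG.c_pos ht (by omega)
  have hci : (c i : ℝ) ≤ C * c t := le_trans (mod_cast hG.c_le_b hi.ge) hC
  have hmul : (c t : ℝ) ^ 2 * i ≤ c t ^ 2 * (6 * C ^ 2 * t) :=
    calc (c t : ℝ) ^ 2 * i ≤ 6 * t * (c i : ℝ) ^ 2 :=
          mod_cast hG.sq_mul_le_of_two_mul_b_lt ht hbt (by omega) (by omega)
      _ ≤ 6 * t * (C * c t) ^ 2 := by gcongr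
      _ = c t ^ 2 * (6 * C ^ 2 * t) := by ring
  have hi_le := le_of_mul_le_mul_left hmul (by positivity)
  rw [hi, Nat.cast_add]
  linarith

end SimpleGraph.IsDistanceRegularWith

theorem lemma10 {V : Type*} [Fintype V] (G : SimpleGraph V) (b c : ℕ → ℕ)
    (hG : G.IsDistanceRegularWith b c) (C : ℝ) (hC : 1 / 2 ≤ C) (t : ℕ) (ht : 1 ≤ t)
    (hD : t + 1 ≤ G.diam) (hbc : (b t : ℝ) / (c t : ℝ) ≤ C) :
    (G.diam : ℝ) ≤ 8 * C ^ 2 * (t : ℝ) ∨ (b 0 : ℝ) ≤ 2 * C := by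
  by_contra! ⟨hdiam, hk⟩
  have hct : (0 : ℝ) < c t := mod_cast hG.c_pos ht (by omega)
  rw [div_le_iff₀ hct] at hbc
  have hbt : 2 * b t < b 0 * c t := by
    have : (2 * b t : ℝ) < b 0 * c t := by nlinarith
    exact_mod_cast this
  have hD₂ : 2 * t ≤ G.diam := by
    have hsq : (1 / 2 : ℝ) ^ 2 * t ≤ C ^ 2 * t := by gcongr
    have : (2 * t : ℝ) ≤ G.diam := by linarith
    exact_mod_cast this
  have hC₁ : 1 ≤ C := by
    have hcb : (c t : ℝ) ≤ b t := mod_cast hG.c_le_b (by omega)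
    exact le_of_mul_le_mul_right (by linarith) hct
  have htC : (t : ℝ) ≤ C ^ 2 * t := le_mul_of_one_le_left (by positivity) (one_le_pow₀ hC₁)
  have hD₃ : 3 * t ≤ G.diam := by
    have : (3 * t : ℝ) ≤ G.diam := by linarith
    exact_mod_cast this
  have hle := hG.diam_le_of_b_le_mul_c ht hbt hD₃ hbc
  linarith
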